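/- By a tree we mean a finite rooted planar binary tree, and $B_n$ denotes the braid group on $n$ strands, with its projection $\rho\colon B_n\to S_n$ ($\rho(\beta)(k)$ is the position at the top of the strand that starts in position $k$ at the bottom). Let $bV$ be the braided Thompson group. Its elements are the equivalence classes $[T_-,\beta,T_+]$ of triples consisting of two trees $T_-,T_+$ with the same number $n\geq 1$ of leaves and a braid $\beta\in B_n$; the equivalence relation is generated by identifying $(T_-,\beta,T_+)$, for each $1\le k\le n$, with its $k$th expansion $(T_-',\beta',T_+')$, where $T_+'$ is $T_+$ with a caret added to its $k$th leaf, $T_-'$ is $T_-$ with a caret added to its $\rho(\beta)(k)$th leaf, and $\beta'\in B_{n+1}$ is $\beta$ with its $k$th strand (counted at the bottom) bifurcated into two parallel strands. The product is determined by $[T_-,\beta,T][T,\gamma,U_+]=[T_-,\beta\gamma,U_+]$. Let $\widehat{bV}\leq bV$ be the subgroup of all classes $[T_-,\beta,T_+]$ of triples in which $\beta$ lies in the standard copy of $B_{n-1}$ in $B_n$ that only braids the first $n-1$ strands (for $n=1$, $\beta$ is the trivial braid). The right depth of a tree is the distance from its rightmost leaf to its root. Let $\chi_1\colon\widehat{bV}\to\mathbf{Z}$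 be the homomorphism that sends the class of such a triple $(T_-,\beta,T_+)$ to the right depth of $T_-$ minus the right depth of $T_+$, and let $\widehat{D}=\ker\chi_1$. **Corollary.** The derived subgroup of $\widehat{bV}$ equals $\widehat{D}$. Hence the abelianisation of $\widehat{bV}$ is $\mathbf{Z}$, given by $\chi_1$; that is, $\chi_1$ induces an isomorphism from the abelianisation of $\widehat{bV}$ to $\mathbf{Z}$. -/

import Mathlib

namespace BraidedV

/-! ### Braid groups -/

/-- Artin's relations for the braid group on `n` strands. The generator with index `i`
(where `i + 1 < n`) crosses the strands in the positions `i` and `i + 1`;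
positions are counted from `0`. -/
def braidRels (n : ℕ) : Set (FreeGroup {i : ℕ // i + 1 < n}) :=
  {r | ∃ i j : {i : ℕ // i + 1 < n}, (j : ℕ) = i + 1 ∧
    r = FreeGroup.of i * FreeGroup.of j * FreeGroup.of i *
      (FreeGroup.of j * FreeGroup.of i * FreeGroup.of j)⁻¹} ∪
  {r | ∃ i j : {i : ℕ // i + 1 < n}, (i : ℕ) + 1 < j ∧
    r = FreeGroup.of i * FreeGroup.of j * (FreeGroup.of j * FreeGroup.of i)⁻¹}

/-- The braid group `B_n`. In a product `β * γ` the braid `β` is stacked on top of `γ`. -/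
abbrev Braid (n : ℕ) : Type := PresentedGroup (braidRels n)

/-- The standard generators of `B_n` (with the value `1` for indices out of range). -/
def sigma (n i : ℕ) : Braid n :=
  if h : i + 1 < n then PresentedGroup.of ⟨i, h⟩ else 1

theorem sigma_of {n : ℕ} (i : {i : ℕ // i + 1 < n}) :
    sigma n i = PresentedGroup.of i := by
  simp [sigma, i.2]

theorem sigma_comm (n : ℕ) {i j : ℕ} (h : i + 1 < j) :
    sigma n i * sigma n j = sigma n j * sigma n i := by
  unfold sigma
  split_ifs with h1 h2
  · exact PresentedGroup.mk_eq_mk_of_mul_inv_mem (Or.inr ⟨⟨i, h1⟩, ⟨j, h2⟩, h, rfl⟩)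
  all_goals simp

theorem sigma_braid (n : ℕ) {i : ℕ} (h : i + 2 < n) :
    sigma n i * sigma n (i + 1) * sigma n i =
      sigma n (i + 1) * sigma n i * sigma n (i + 1) := by
  have h1 : i + 1 < n := by omega
  have h2 : i + 1 + 1 < n := by omega
  simp only [sigma, h1, h2, dif_pos]
  exact PresentedGroup.mk_eq_mk_of_mul_inv_mem (Or.inl ⟨⟨i, h1⟩, ⟨i + 1, h2⟩, rfl, rfl⟩)

theorem braid_induction {n : ℕ} {P : Braid n → Prop}
    (gen : ∀ i, i + 1 < n → P (sigma n i)) (one : P 1)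
    (mul : ∀ β γ, P β → P γ → P (β * γ)) (inv : ∀ β, P β → P β⁻¹) (β : Braid n) : P β :=
  PresentedGroup.generated_by _
    { carrier := {β | P β}, mul_mem' := mul _ _, one_mem' := one, inv_mem' := inv _ }
    (fun j => by
      have := gen j j.2
      rwa [sigma_of] at this) β

theorem swap_braid (i : ℕ) :
    Equiv.swap i (i + 1) * Equiv.swap (i + 1) (i + 1 + 1) * Equiv.swap i (i + 1) =
    Equiv.swap (i + 1) (i + 1 + 1) * Equiv.swap i (i + 1) *
      Equiv.swap (i + 1) (i + 1 + 1) := by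
  ext k
  simp only [Equiv.Perm.mul_apply, Equiv.swap_apply_def]
  split_ifs <;> omega

theorem swap_comm {i j : ℕ} (h : i + 1 < j) :
    Equiv.swap i (i + 1) * Equiv.swap j (j + 1) =
    Equiv.swap j (j + 1) * Equiv.swap i (i + 1) := by
  ext k
  simp only [Equiv.Perm.mul_apply, Equiv.swap_apply_def]
  split_ifs <;> omega

theorem rho_rels (n : ℕ) : ∀ r ∈ braidRels n,
    FreeGroup.lift (fun i : {i : ℕ // i + 1 < n} => Equiv.swap (i : ℕ) (i + 1)) r = 1 := by
  rintro r (⟨i, j, hij, rfl⟩ | ⟨i, j, hij, rfl⟩)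
  · simp only [map_mul, map_inv, FreeGroup.lift_apply_of, mul_inv_eq_one, hij]
    exact swap_braid _
  · simp only [map_mul, map_inv, FreeGroup.lift_apply_of, mul_inv_eq_one]
    exact swap_comm hij

/-- The projection of `B_n` onto the symmetric group: `rho n β k` is the position at the top of
the strand of `β` that starts in position `k` at the bottom. Permutations of `{0, …, n - 1}`
are seen as permutations of `ℕ` that fix all `k ≥ n`. -/
def rho (n : ℕ) : Braid n →* Equiv.Perm ℕ := PresentedGroup.toGroup (rho_rels n)

theorem rho_sigma {n i : ℕ} (h : i + 1 < n) : rho n (sigma n i) = Equiv.swap i (i + 1) := by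
  simp [sigma, h, rho]

theorem rho_fix {n : ℕ} (β : Braid n) : ∀ k, n ≤ k → rho n β k = k := by
  induction β using braid_induction with
  | gen i h =>
    intro k hk
    rw [rho_sigma h]
    exact Equiv.swap_apply_of_ne_of_ne (by omega) (by omega)
  | one => simp
  | mul β γ hβ hγ =>
    intro k hk
    rw [map_mul, Equiv.Perm.mul_apply, hγ k hk, hβ k hk]
  | inv β hβ =>
    intro k hk
    rw [map_inv, Equiv.Perm.inv_eq_iff_eq, hβ k hk]

theorem rho_lt {n : ℕ} (β : Braid n) {k : ℕ} (hk : k < n) : rho n β k < n := by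
  by_contra h
  have h1 := rho_fix β _ (not_lt.mp h)
  have h2 := (rho n β).injective h1
  omega

/-! ### Bifurcating a strand -/

/-- The braid in `B_{n+1}` obtained from the generator `sigma n i` by bifurcating into two parallel
strands the strand that starts in position `k` at the bottom. -/
def cloneGen (n k i : ℕ) : Braid (n + 1) :=
  if k < i then sigma (n + 1) (i + 1)
  else if k = i then sigma (n + 1) i * sigma (n + 1) (i + 1)
  else if k = i + 1 then sigma (n + 1) (i + 1) * sigma (n + 1) i
  else sigma (n + 1) i

theorem cloneGen_lt {n k i : ℕ} (h : k < i) : cloneGen n k i = sigma (n + 1) (i + 1) := by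
  simp [cloneGen, h]

theorem cloneGen_self (n i : ℕ) :
    cloneGen n i i = sigma (n + 1) i * sigma (n + 1) (i + 1) := by
  simp [cloneGen]

theorem cloneGen_succ (n i : ℕ) :
    cloneGen n (i + 1) i = sigma (n + 1) (i + 1) * sigma (n + 1) i := by
  simp [cloneGen]

theorem cloneGen_gt {n k i : ℕ} (h : i + 1 < k) : cloneGen n k i = sigma (n + 1) i := by
  have h1 : ¬ k < i := by omega
  have h2 : k ≠ i := by omega
  have h3 : k ≠ i + 1 := by omega
  simp [cloneGen, h1, h2, h3]

theorem cloneGen_braid {n i : ℕ} (h : i + 2 < n) (k : ℕ) :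
    cloneGen n (Equiv.swap (i + 1) (i + 1 + 1) (Equiv.swap i (i + 1) k)) i *
      cloneGen n (Equiv.swap i (i + 1) k) (i + 1) * cloneGen n k i =
    cloneGen n (Equiv.swap i (i + 1) (Equiv.swap (i + 1) (i + 1 + 1) k)) (i + 1) *
      cloneGen n (Equiv.swap (i + 1) (i + 1 + 1) k) i * cloneGen n k (i + 1) := by
  have hab := sigma_braid (n + 1) (i := i) (by omega)
  have hbc := sigma_braid (n + 1) (i := i + 1) (by omega)
  have hac := sigma_comm (n + 1) (i := i) (j := i + 1 + 1) (by omega)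
  have e : ∀ a b k : ℕ, k ≠ a → k ≠ b → Equiv.swap a b k = k :=
    fun a b k h1 h2 => Equiv.swap_apply_of_ne_of_ne h1 h2
  rcases (by omega : k < i ∨ k = i ∨ k = i + 1 ∨ k = i + 1 + 1 ∨ i + 1 + 1 < k) with
    h1 | rfl | rfl | rfl | h1
  · rw [e i (i + 1) k (by omega) (by omega), e (i + 1) (i + 1 + 1) k (by omega) (by omega),
      e i (i + 1) k (by omega) (by omega), cloneGen_lt h1, cloneGen_lt (by omega)]
    exact hbc
  · rw [Equiv.swap_apply_left, Equiv.swap_apply_left,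
      e (k + 1) (k + 1 + 1) k (by omega) (by omega), Equiv.swap_apply_left,
      cloneGen_gt (by omega), cloneGen_self, cloneGen_self, cloneGen_lt (by omega)]
    generalize sigma (n + 1) k = a at *
    generalize sigma (n + 1) (k + 1) = b at *
    generalize sigma (n + 1) (k + 1 + 1) = c at *
    calc a * (b * c) * (a * b) = a * b * (c * a) * b := by simp only [mul_assoc]
      _ = a * b * a * (c * b) := by rw [← hac]; simp only [mul_assoc]
      _ = b * a * (b * c * b) := by rw [hab]; simp only [mul_assoc]
      _ = b * (a * c) * (b * c) := by rw [hbc]; simp only [mul_assoc]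
      _ = b * c * (a * b) * c := by rw [hac]; simp only [mul_assoc]
  · rw [Equiv.swap_apply_right, e (i + 1) (i + 1 + 1) i (by omega) (by omega),
      Equiv.swap_apply_left, e i (i + 1) (i + 1 + 1) (by omega) (by omega),
      cloneGen_self, cloneGen_lt (by omega), cloneGen_succ, cloneGen_succ,
      cloneGen_gt (by omega), cloneGen_self]
    generalize sigma (n + 1) i = a at *
    generalize sigma (n + 1) (i + 1) = b at *
    generalize sigma (n + 1) (i + 1 + 1) = c at *
    calc a * b * c * (b * a) = a * (b * c * b) * a := by simp only [mul_assoc]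
      _ = (a * c) * b * (c * a) := by rw [hbc]; simp only [mul_assoc]
      _ = c * (a * b * a) * c := by rw [← hac]; nth_rw 1 [hac]; simp only [mul_assoc]
      _ = c * b * a * (b * c) := by rw [hab]; simp only [mul_assoc]
  · rw [e i (i + 1) (i + 1 + 1) (by omega) (by omega), Equiv.swap_apply_right,
      Equiv.swap_apply_right, cloneGen_succ, cloneGen_succ, cloneGen_gt (by omega),
      cloneGen_lt (by omega)]
    generalize sigma (n + 1) i = a at *
    generalize sigma (n + 1) (i + 1) = b at *
    generalize sigma (n + 1) (i + 1 + 1) = c at *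
    calc b * a * (c * b) * a = b * (a * c) * b * a := by simp only [mul_assoc]
      _ = b * c * (a * b * a) := by rw [hac]; simp only [mul_assoc]
      _ = (b * c * b) * a * b := by rw [hab]; simp only [mul_assoc]
      _ = c * b * (c * a) * b := by rw [hbc]; simp only [mul_assoc]
      _ = c * (b * a) * (c * b) := by rw [← hac]; simp only [mul_assoc]
  · rw [e i (i + 1) k (by omega) (by omega), e (i + 1) (i + 1 + 1) k (by omega) (by omega),
      e i (i + 1) k (by omega) (by omega), cloneGen_gt (by omega), cloneGen_gt (by omega)]
    exact hab

theorem cloneGen_comm {n i j : ℕ} (h : i + 1 < j) (k : ℕ) :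
    cloneGen n (Equiv.swap j (j + 1) k) i * cloneGen n k j =
    cloneGen n (Equiv.swap i (i + 1) k) j * cloneGen n k i := by
  have e : ∀ a b k : ℕ, k ≠ a → k ≠ b → Equiv.swap a b k = k :=
    fun a b k h1 h2 => Equiv.swap_apply_of_ne_of_ne h1 h2
  have c1 := sigma_comm (n + 1) (i := i) (j := j) (by omega)
  have c2 := sigma_comm (n + 1) (i := i) (j := j + 1) (by omega)
  have c3 := sigma_comm (n + 1) (i := i + 1) (j := j + 1) (by omega)
  rcases (by omega : k < i ∨ k = i ∨ k = i + 1 ∨ (i + 1 < k ∧ k < j) ∨ k = j ∨ k = j + 1 ∨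
    j + 1 < k) with h1 | rfl | rfl | h1 | rfl | rfl | h1
  · rw [e j (j + 1) k (by omega) (by omega), e i (i + 1) k (by omega) (by omega),
      cloneGen_lt h1, cloneGen_lt (by omega)]
    exact c3
  · rw [e j (j + 1) k (by omega) (by omega), Equiv.swap_apply_left,
      cloneGen_self, cloneGen_lt (by omega), cloneGen_lt (by omega), mul_assoc, c3,
      ← mul_assoc, c2, mul_assoc]
  · rw [e j (j + 1) (i + 1) (by omega) (by omega), Equiv.swap_apply_right,
      cloneGen_succ, cloneGen_lt (by omega), cloneGen_lt (by omega), mul_assoc, c2,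
      ← mul_assoc, c3, mul_assoc]
  · rw [e j (j + 1) k (by omega) (by omega), e i (i + 1) k (by omega) (by omega),
      cloneGen_gt h1.1, cloneGen_lt h1.2]
    exact c2
  · rw [Equiv.swap_apply_left, e i (i + 1) k (by omega) (by omega), cloneGen_self,
      cloneGen_gt (by omega), cloneGen_gt (by omega), ← mul_assoc, c1, mul_assoc, c2,
      ← mul_assoc]
  · rw [Equiv.swap_apply_right, e i (i + 1) (j + 1) (by omega) (by omega), cloneGen_succ,
      cloneGen_gt (by omega), cloneGen_gt (by omega), ← mul_assoc, c2, mul_assoc, c1,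
      ← mul_assoc]
  · rw [e j (j + 1) k (by omega) (by omega), e i (i + 1) k (by omega) (by omega),
      cloneGen_gt (by omega), cloneGen_gt (by omega)]
    exact c1

/-- The wreath product of `G` with the permutations of `ℕ`. -/
abbrev Wreath (G : Type) [Group G] : Type :=
  (ℕ → G) ⋊[mulAutArrow (G := Equiv.Perm ℕ)] Equiv.Perm ℕ

theorem wreath_left {G : Type} [Group G] (x y : Wreath G) (p : ℕ) :
    (x * y).left p = x.left p * y.left (x.right⁻¹ p) := rfl

/-- The image of a generator under `cloneHom`. -/
def cloneHomGen (n : ℕ) (i : {i : ℕ // i + 1 < n}) : Wreath (Braid (n + 1)) :=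
  ⟨fun p => cloneGen n (Equiv.swap (i : ℕ) (i + 1) p) i, Equiv.swap (i : ℕ) (i + 1)⟩

theorem cloneHom_rels (n : ℕ) : ∀ r ∈ braidRels n, FreeGroup.lift (cloneHomGen n) r = 1 := by
  rintro r (⟨i, ⟨j, hj⟩, hij, rfl⟩ | ⟨i, j, hij, rfl⟩)
  · simp only [map_mul, map_inv, FreeGroup.lift_apply_of, mul_inv_eq_one]
    obtain rfl : j = i + 1 := hij
    refine SemidirectProduct.ext ?_ (swap_braid _)
    funext p
    obtain ⟨k, rfl⟩ := (Equiv.swap (i : ℕ) (i + 1) *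
      Equiv.swap ((i : ℕ) + 1) (i + 1 + 1) * Equiv.swap (i : ℕ) (i + 1)).surjective p
    have key := cloneGen_braid (n := n) (i := i) (by omega) k
    conv_rhs => rw [swap_braid]
    simpa [wreath_left, cloneHomGen, mul_assoc, -SemidirectProduct.mk_eq_inl_mul_inr] using key
  · simp only [map_mul, map_inv, FreeGroup.lift_apply_of, mul_inv_eq_one]
    refine SemidirectProduct.ext ?_ (swap_comm hij)
    funext p
    obtain ⟨k, rfl⟩ := (Equiv.swap (i : ℕ) (i + 1) *
      Equiv.swap (j : ℕ) (j + 1)).surjective p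
    have key := cloneGen_comm (n := n) hij k
    conv_rhs => rw [swap_comm hij]
    simpa [wreath_left, cloneHomGen, mul_assoc, -SemidirectProduct.mk_eq_inl_mul_inr] using key

/-- Bifurcation of all strands at once. The first component of `cloneHom n β` maps `p` to the braid
obtained from `β` by bifurcating the strand that ends in position `p` at the top, the second one
is the permutation of `β`. -/
def cloneHom (n : ℕ) : Braid n →* Wreath (Braid (n + 1)) :=
  PresentedGroup.toGroup (cloneHom_rels n)

/-- The braid in `B_{n+1}` obtained from `β` by bifurcating into two parallel strands
the strand that starts in position `k` at the bottom. -/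
def clone {n : ℕ} (k : ℕ) (β : Braid n) : Braid (n + 1) := (cloneHom n β).left (rho n β k)

theorem cloneHom_right {n : ℕ} (β : Braid n) : (cloneHom n β).right = rho n β := by
  have : (SemidirectProduct.rightHom.comp (cloneHom n)) = rho n := by
    ext i : 1
    simp [cloneHom, rho, cloneHomGen]
  exact DFunLike.congr_fun this β

theorem clone_sigma {n k i : ℕ} (h : i + 1 < n) : clone k (sigma n i) = cloneGen n k i := by
  unfold clone
  rw [rho_sigma h]
  simp [sigma, h, cloneHom, cloneHomGen, -SemidirectProduct.mk_eq_inl_mul_inr]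

theorem clone_one {n : ℕ} (k : ℕ) : clone k (1 : Braid n) = 1 := by
  simp [clone]

/-- To bifurcate a strand of a product, bifurcate it in both factors. -/
theorem clone_mul {n : ℕ} (k : ℕ) (β γ : Braid n) :
    clone k (β * γ) = clone (rho n γ k) β * clone k γ := by
  unfold clone
  rw [map_mul, map_mul, wreath_left, cloneHom_right]
  simp

theorem clone_inv {n : ℕ} (k : ℕ) (β : Braid n) :
    clone k β⁻¹ = (clone ((rho n β)⁻¹ k) β)⁻¹ := by
  have h := clone_mul k β β⁻¹
  rw [mul_inv_cancel, clone_one, map_inv] at h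
  exact eq_inv_of_mul_eq_one_right h.symm

/-- The new position of the leaf or strand `l` once the leaf or strand `k` is bifurcated. -/
def shift (k l : ℕ) : ℕ := if k < l then l + 1 else l

theorem rho_clone {n : ℕ} (β : Braid n) : ∀ k l : ℕ,
    rho (n + 1) (clone k β) (shift k l) = shift (rho n β k) (rho n β l) := by
  induction β using braid_induction with
  | gen i h =>
    intro k l
    have e1 := rho_sigma (n := n + 1) (i := i) (by omega)
    have e2 := rho_sigma (n := n + 1) (i := i + 1) (by omega)
    rw [clone_sigma h, rho_sigma h]
    rcases (by omega : k < i ∨ k = i ∨ k = i + 1 ∨ i + 1 < k) with h1 | rfl | rfl | h1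
    · rw [cloneGen_lt h1, e2]
      simp only [shift, Equiv.swap_apply_def]
      split_ifs <;> omega
    · rw [cloneGen_self, map_mul, e1, e2]
      simp only [shift, Equiv.swap_apply_def, Equiv.Perm.mul_apply]
      split_ifs <;> omega
    · rw [cloneGen_succ, map_mul, e1, e2]
      simp only [shift, Equiv.swap_apply_def, Equiv.Perm.mul_apply]
      split_ifs <;> omega
    · rw [cloneGen_gt h1, e1]
      simp only [shift, Equiv.swap_apply_def]
      split_ifs <;> omega
  | one => simp [clone_one]
  | mul β γ hβ hγ =>
    intro k l
    rw [clone_mul, map_mul, Equiv.Perm.mul_apply, hγ, hβ, map_mul]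
    rfl
  | inv β hβ =>
    intro k l
    rw [clone_inv, map_inv, Equiv.Perm.inv_eq_iff_eq, map_inv, hβ]
    simp

theorem clone_cloneGen {n i k l : ℕ} (h : i + 1 < n) (hkl : k < l) :
    clone (l + 1) (cloneGen n k i) = clone k (cloneGen n l i) := by
  have r1 := rho_sigma (n := n + 1) (i := i) (by omega)
  have r2 := rho_sigma (n := n + 1) (i := i + 1) (by omega)
  have c1 : ∀ k, clone k (sigma (n + 1) i) = cloneGen (n + 1) k i :=
    fun k => clone_sigma (by omega)
  have c2 : ∀ k, clone k (sigma (n + 1) (i + 1)) = cloneGen (n + 1) k (i + 1) :=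
    fun k => clone_sigma (by omega)
  have hac := sigma_comm (n + 2) (i := i) (j := i + 1 + 1) (by omega)
  have e : ∀ a b k : ℕ, k ≠ a → k ≠ b → Equiv.swap a b k = k :=
    fun a b k h1 h2 => Equiv.swap_apply_of_ne_of_ne h1 h2
  rcases (by omega : k < i ∨ k = i ∨ k = i + 1 ∨ i + 1 < k) with h1 | rfl | rfl | h1
  · rw [cloneGen_lt h1, c2]
    rcases (by omega : l < i ∨ l = i ∨ l = i + 1 ∨ i + 1 < l) with h2 | rfl | rfl | h2
    · rw [cloneGen_lt h2, c2, cloneGen_lt (by omega), cloneGen_lt (by omega)]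
    · rw [cloneGen_self, cloneGen_self, clone_mul, r2, e _ _ _ (by omega) (by omega), c1, c2,
        cloneGen_lt (by omega), cloneGen_lt (by omega)]
    · rw [cloneGen_succ, cloneGen_succ, clone_mul, r1, e _ _ _ (by omega) (by omega), c1, c2,
        cloneGen_lt (by omega), cloneGen_lt (by omega)]
    · rw [cloneGen_gt h2, cloneGen_gt (by omega), c1, cloneGen_lt (by omega)]
  · rw [cloneGen_self, clone_mul, r2]
    rcases (by omega : l = k + 1 ∨ k + 1 < l) with rfl | h2
    · rw [Equiv.swap_apply_right, cloneGen_succ, clone_mul, r1, Equiv.swap_apply_left, c1, c2,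
        c1, c2, cloneGen_succ, cloneGen_succ, cloneGen_self, cloneGen_self]
      simp only [mul_assoc]
      rw [← mul_assoc (sigma (n + 1 + 1) k), hac]
      simp only [mul_assoc]
    · rw [e _ _ _ (by omega) (by omega), c1, c2, cloneGen_gt (by omega), cloneGen_gt (by omega),
        cloneGen_gt (by omega), c1, cloneGen_self]
  · rw [cloneGen_succ, clone_mul, r1, e _ _ _ (by omega) (by omega), c1, c2,
      cloneGen_gt (by omega), cloneGen_gt (by omega), cloneGen_gt (by omega), c1, cloneGen_succ]
  · rw [cloneGen_gt h1, cloneGen_gt (by omega), c1, c1, cloneGen_gt (by omega),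
      cloneGen_gt (by omega)]

/-- Bifurcations of two different strands commute. -/
theorem clone_clone {n : ℕ} (β : Braid n) : ∀ k l : ℕ,
    clone (shift k l) (clone k β) = clone (shift l k) (clone l β) := by
  induction β using braid_induction with
  | gen i h =>
    intro k l
    rw [clone_sigma h, clone_sigma h]
    rcases lt_trichotomy k l with hkl | rfl | hkl
    · simpa [shift, hkl, hkl.not_gt] using clone_cloneGen h hkl
    · rfl
    · simpa [shift, hkl, hkl.not_gt] using (clone_cloneGen h hkl).symm
  | one => simp [clone_one]
  | mul β γ hβ hγ =>
    intro k l
    rw [clone_mul, clone_mul, rho_clone, hβ, hγ, clone_mul, clone_mul, rho_clone]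
  | inv β hβ =>
    intro k l
    have e : ∀ k l, (rho (n + 1) (clone ((rho n β)⁻¹ k) β))⁻¹ (shift k l) =
        shift ((rho n β)⁻¹ k) ((rho n β)⁻¹ l) := by
      intro k l
      rw [Equiv.Perm.inv_eq_iff_eq, rho_clone]
      simp
    rw [clone_inv k, clone_inv, e, hβ, clone_inv l, clone_inv, e]

/-! ### Trees -/

/-- Finite rooted planar binary trees; `nil` is the trivial tree, whose root is its only leaf. -/
abbrev Tree : Type := BinaryTree Unit

/-- The number of leaves of a tree. -/
def leaves : Tree → ℕ
  | .nil => 1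
  | .node _ l r => leaves l + leaves r

/-- The tree obtained by adding a caret to the leaf with the index `k`; leaves are counted from left
to right, starting from `0`. It is used for `k < leaves T` only. -/
def addCaret : Tree → ℕ → Tree
  | .nil, _ => .node () .nil .nil
  | .node _ l r, k =>
    if k < leaves l then .node () (addCaret l k) r else .node () l (addCaret r (k - leaves l))

/-- The right depth of a tree: the distance from its rightmost leaf to its root. -/
def rightDepth : Tree → ℕ
  | .nil => 0
  | .node _ _ r => rightDepth r + 1

theorem leaves_pos (T : Tree) : 0 < leaves T := by
  induction T with
  | nil => simp [leaves]
  | node _ l r hl hr => simp only [leaves]; omega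

theorem leaves_addCaret (T : Tree) : ∀ {k : ℕ}, k < leaves T →
    leaves (addCaret T k) = leaves T + 1 := by
  induction T with
  | nil => intro k _; simp [addCaret, leaves]
  | node _ l r hl hr =>
    intro k hk
    simp only [leaves] at hk
    simp only [addCaret]
    split_ifs with h
    · simp only [leaves, hl h]; omega
    · simp only [leaves, hr (k := k - leaves l) (by omega)]; omega

theorem rightDepth_addCaret (T : Tree) : ∀ {k : ℕ}, k < leaves T →
    rightDepth (addCaret T k) = if k + 1 = leaves T then rightDepth T + 1 else rightDepth T := by
  induction T with
  | nil => intro k hk; simp [leaves] at hk; simp [addCaret, rightDepth, leaves, hk]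
  | node _ l r hl hr =>
    intro k hk
    simp only [leaves] at hk
    have := leaves_pos r
    simp only [addCaret]
    split_ifs with h h1 h1
    · simp only [leaves] at h1; omega
    · simp only [rightDepth]
    · simp only [leaves] at h1
      simp only [rightDepth]
      rw [hr (by omega), if_pos (by omega)]
    · simp only [leaves] at h1
      simp only [rightDepth]
      rw [hr (by omega), if_neg (by omega)]

theorem addCaret_addCaret (T : Tree) : ∀ {k l : ℕ}, k < leaves T → l < leaves T →
    addCaret (addCaret T k) (shift k l) = addCaret (addCaret T l) (shift l k) := by
  suffices H : ∀ {k l : ℕ}, k < l → l < leaves T →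
      addCaret (addCaret T k) (l + 1) = addCaret (addCaret T l) k by
    intro k l hk hl
    rcases lt_trichotomy k l with h | rfl | h
    · simpa [shift, h, h.not_gt] using H h hl
    · rfl
    · simpa [shift, h, h.not_gt] using (H h hk).symm
  induction T with
  | nil => intro k l h1 h2; simp only [leaves] at h2; omega
  | node _ a b ha hb =>
    intro k l h1 h2
    simp only [leaves] at h2
    by_cases hl : l < leaves a
    · have hk : k < leaves a := by omega
      have e1 := leaves_addCaret a hk
      have e2 := leaves_addCaret a hl
      have g1 : l + 1 < leaves (addCaret a k) := by omega
      have g2 : k < leaves (addCaret a l) := by omega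
      simp only [addCaret, hk, hl, if_true, g1, g2, ha h1 hl]
    · by_cases hk : k < leaves a
      · have e1 := leaves_addCaret a hk
        have g1 : ¬ l + 1 < leaves (addCaret a k) := by omega
        have g2 : l + 1 - leaves (addCaret a k) = l - leaves a := by omega
        simp only [addCaret, hk, hl, if_true, if_false, g1, g2]
      · have g1 : ¬ l + 1 < leaves a := by omega
        have g2 : l + 1 - leaves a = l - leaves a + 1 := by omega
        simp only [addCaret, hk, hl, if_false, g1, g2]
        rw [hb (by omega) (by omega)]

/-- `Le A B` says that the tree `A` is a rooted subtree of `B`. -/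
def Le : Tree → Tree → Prop
  | .nil, _ => True
  | .node _ _ _, .nil => False
  | .node _ l r, .node _ l' r' => Le l l' ∧ Le r r'

theorem Le.refl (A : Tree) : Le A A := by
  induction A with
  | nil => trivial
  | node _ l r hl hr => exact ⟨hl, hr⟩

theorem Le.trans {A B C : Tree} (h1 : Le A B) (h2 : Le B C) : Le A C := by
  induction A generalizing B C with
  | nil => trivial
  | node _ l r hl hr =>
    cases B with
    | nil => exact h1.elim
    | node _ l' r' =>
      cases C with
      | nil => exact h2.elim
      | node _ l'' r'' => exact ⟨hl h1.1 h2.1, hr h1.2 h2.2⟩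

theorem le_addCaret (A : Tree) (k : ℕ) : Le A (addCaret A k) := by
  induction A generalizing k with
  | nil => trivial
  | node _ l r hl hr =>
    simp only [addCaret]
    split_ifs
    · exact ⟨hl _, Le.refl _⟩
    · exact ⟨Le.refl _, hr _⟩

theorem Le.leaves_le {A B : Tree} (h : Le A B) : leaves A ≤ leaves B := by
  induction A generalizing B with
  | nil => exact leaves_pos B
  | node _ l r hl hr =>
    cases B with
    | nil => exact h.elim
    | node _ l' r' => exact Nat.add_le_add (hl h.1) (hr h.2)

theorem exists_le_le (A B : Tree) : ∃ C, Le A C ∧ Le B C := by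
  induction A generalizing B with
  | nil => exact ⟨B, trivial, Le.refl B⟩
  | node a l r hl hr =>
    cases B with
    | nil => exact ⟨_, Le.refl _, trivial⟩
    | node _ l' r' =>
      obtain ⟨c, h1, h2⟩ := hl l'
      obtain ⟨d, h3, h4⟩ := hr r'
      exact ⟨.node () c d, ⟨h1, h3⟩, ⟨h2, h4⟩⟩

theorem Le.eq_or {A T : Tree} (h : Le A T) : A = T ∨ ∃ k < leaves A, Le (addCaret A k) T := by
  induction A generalizing T with
  | nil =>
    cases T with
    | nil => exact Or.inl rfl
    | node _ l r => exact Or.inr ⟨0, by simp [leaves], trivial, trivial⟩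
  | node _ l r hl hr =>
    cases T with
    | nil => exact h.elim
    | node _ l' r' =>
      rcases hl h.1 with rfl | ⟨k, hk, h1⟩
      · rcases hr h.2 with rfl | ⟨k, hk, h1⟩
        · exact Or.inl rfl
        · refine Or.inr ⟨leaves l + k, by simp only [leaves]; omega, ?_⟩
          simp only [addCaret]
          rw [if_neg (by omega), Nat.add_sub_cancel_left]
          exact ⟨Le.refl _, h1⟩
      · refine Or.inr ⟨k, by simp only [leaves]; omega, ?_⟩
        simp only [addCaret, hk, if_true]
        exact ⟨h1, h.2⟩

theorem Le.join {A T : Tree} {k l : ℕ} (hk : k < leaves A) (hl : l < leaves A) (hkl : k ≠ l)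
    (h1 : Le (addCaret A k) T) (h2 : Le (addCaret A l) T) :
    Le (addCaret (addCaret A k) (shift k l)) T := by
  induction A generalizing T k l with
  | nil => simp only [leaves] at hk hl; omega
  | node _ a b ha hb =>
    simp only [leaves] at hk hl
    cases T with
    | nil =>
      simp only [addCaret] at h1
      split_ifs at h1 <;> exact h1.elim
    | node _ c d =>
      by_cases gk : k < leaves a <;> by_cases gl : l < leaves a <;>
        simp only [addCaret, gk, gl, if_true, if_false, Le] at h1 h2 ⊢
      · have := leaves_addCaret a gk
        have g : shift k l < leaves (addCaret a k) := by unfold shift; split_ifs <;> omega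
        simp only [g, if_true, Le]
        exact ⟨ha gk gl hkl h1.1 h2.1, h1.2⟩
      · have := leaves_addCaret a gk
        have g : ¬ shift k l < leaves (addCaret a k) := by unfold shift; split_ifs <;> omega
        have g' : shift k l - leaves (addCaret a k) = l - leaves a := by
          unfold shift; split_ifs <;> omega
        simp only [g, if_false, Le, g']
        exact ⟨h1.1, h2.2⟩
      · have g' : shift k l = l := by unfold shift; split_ifs <;> omega
        simp only [g', gl, if_true, Le]
        exact ⟨h2.1, h1.2⟩
      · have g : ¬ shift k l < leaves a := by unfold shift; split_ifs <;> omega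
        have g' : shift k l - leaves a = shift (k - leaves a) (l - leaves a) := by
          unfold shift; split_ifs <;> omega
        simp only [g, if_false, Le, g']
        exact ⟨h1.1, hb (by omega) (by omega) (by omega) h1.2 h2.2⟩

/-! ### Representative triples and their expansions -/

/-- A representative triple `(neg, braid, pos)`: two trees with `n` leaves and a braid on `n`
strands, which leads from the leaves of `pos` (bottom) to those of `neg` (top). -/
structure Triple where
  n : ℕ
  neg : Tree
  braid : Braid n
  pos : Tree
  leaves_neg : leaves neg = n
  leaves_pos : leaves pos = n

theorem Triple.lt_pos (t : Triple) {k : ℕ} (hk : k < t.n) : k < leaves t.pos := by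
  rwa [t.leaves_pos]

theorem Triple.lt_neg (t : Triple) {k : ℕ} (hk : k < t.n) :
    rho t.n t.braid k < leaves t.neg := by
  rw [t.leaves_neg]
  exact rho_lt t.braid hk

/-- The expansion of a triple at the leaf `k` of its tree `pos`. -/
def Triple.expand (t : Triple) (k : ℕ) (hk : k < t.n) : Triple where
  n := t.n + 1
  neg := addCaret t.neg (rho t.n t.braid k)
  braid := clone k t.braid
  pos := addCaret t.pos k
  leaves_neg := by rw [leaves_addCaret _ (t.lt_neg hk), t.leaves_neg]
  leaves_pos := by rw [leaves_addCaret _ (t.lt_pos hk), t.leaves_pos]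

/-- `t'` is an expansion of `t`. -/
def Step (t t' : Triple) : Prop := ∃ (k : ℕ) (hk : k < t.n), t' = t.expand k hk

/-- `t'` arises from `t` by finitely many expansions. -/
abbrev Steps : Triple → Triple → Prop := Relation.ReflTransGen Step

theorem Triple.mk_congr {n : ℕ} {A A' : Tree} {β β' : Braid n} {B B' : Tree} {h1 h2 h1' h2'}
    (hA : A = A') (hβ : β = β') (hB : B = B') :
    Triple.mk n A β B h1 h2 = Triple.mk n A' β' B' h1' h2' := by
  subst hA; subst hβ; subst hB; rfl

theorem shift_lt {k l n : ℕ} (hl : l < n) : shift k l < n + 1 := by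
  unfold shift; split_ifs <;> omega

theorem Triple.expand_expand (t : Triple) {k l : ℕ} (hk : k < t.n) (hl : l < t.n) :
    (t.expand k hk).expand (shift k l) (shift_lt hl) =
      (t.expand l hl).expand (shift l k) (shift_lt hk) := by
  refine Triple.mk_congr ?_ (clone_clone t.braid k l)
    (addCaret_addCaret _ (t.lt_pos hk) (t.lt_pos hl))
  change addCaret (addCaret t.neg _) (rho (t.n + 1) (clone k t.braid) (shift k l)) =
    addCaret (addCaret t.neg _) (rho (t.n + 1) (clone l t.braid) (shift l k))
  rw [rho_clone, rho_clone]
  exact addCaret_addCaret _ (t.lt_neg hk) (t.lt_neg hl)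

theorem Steps.le_pos {t t' : Triple} (h : Steps t t') : Le t.pos t'.pos := by
  induction h with
  | refl => exact Le.refl _
  | tail _ h ih => obtain ⟨k, hk, rfl⟩ := h; exact ih.trans (le_addCaret _ _)

theorem Steps.le_neg {t t' : Triple} (h : Steps t t') : Le t.neg t'.neg := by
  induction h with
  | refl => exact Le.refl _
  | tail _ h ih => obtain ⟨k, hk, rfl⟩ := h; exact ih.trans (le_addCaret _ _)

theorem exists_steps_pos {t : Triple} {T : Tree} (h : Le t.pos T) :
    ∃ s, Steps t s ∧ s.pos = T := by
  induction hm : leaves T - t.n generalizing t with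
  | zero =>
    rcases h.eq_or with h1 | ⟨k, hk, h1⟩
    · exact ⟨t, .refl, h1⟩
    · have := h1.leaves_le
      rw [leaves_addCaret _ hk, t.leaves_pos] at this
      omega
  | succ m ih =>
    rcases h.eq_or with h1 | ⟨k, hk, h1⟩
    · exact ⟨t, .refl, h1⟩
    · rw [t.leaves_pos] at hk
      obtain ⟨s, h2, h3⟩ := ih (t := t.expand k hk) h1 (by change _ - (t.n + 1) = m; omega)
      exact ⟨s, .head ⟨k, hk, rfl⟩ h2, h3⟩

theorem Steps.eq_of_leaves_le {t u : Triple} (h : Steps t u) (hu : leaves u.pos ≤ t.n) :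
    u = t := by
  rcases Relation.ReflTransGen.cases_head h with h1 | ⟨w, ⟨k, hk, rfl⟩, h2⟩
  · exact h1.symm
  · have := (Steps.le_pos h2).leaves_le
    rw [(t.expand k hk).leaves_pos] at this
    change t.n + 1 ≤ _ at this
    omega

/-- A sequence of expansions is determined by the tree `pos` in which it results. -/
theorem Steps.unique {t s s' : Triple} (h : Steps t s) (h' : Steps t s') (e : s.pos = s'.pos) :
    s = s' := by
  induction hm : leaves s.pos - t.n generalizing t s s' with
  | zero =>
    rw [Steps.eq_of_leaves_le h (by omega), Steps.eq_of_leaves_le h' (by rw [← e]; omega)]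
  | succ m ih =>
    rcases Relation.ReflTransGen.cases_head h with h1 | ⟨w, ⟨k, hk, rfl⟩, h2⟩
    · rw [← h1, t.leaves_pos] at hm; omega
    rcases Relation.ReflTransGen.cases_head h' with h1 | ⟨w, ⟨l, hl, rfl⟩, h2'⟩
    · rw [e, ← h1, t.leaves_pos] at hm; omega
    have m1 : leaves s.pos - (t.n + 1) = m := by omega
    by_cases hkl : k = l
    · subst hkl
      exact ih h2 h2' e m1
    · have hj : Le ((t.expand k hk).expand (shift k l) (shift_lt hl)).pos s.pos := by
        refine Le.join (t.lt_pos hk) (t.lt_pos hl) hkl (Steps.le_pos h2) ?_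
        rw [e]
        exact Steps.le_pos h2'
      obtain ⟨v, h3, h4⟩ := exists_steps_pos hj
      have h5 : s = v := ih h2 (.head ⟨_, _, rfl⟩ h3) h4.symm m1
      have h6 : s' = v := by
        refine ih h2' (.head ⟨shift l k, shift_lt hk, t.expand_expand hk hl⟩ h3)
          (e.symm.trans h4.symm) ?_
        rw [← e]
        exact m1
      rw [h5, h6]

/-- Any two sequences of expansions of a triple have a common continuation. -/
theorem Steps.join {t s s' : Triple} (h : Steps t s) (h' : Steps t s') :
    ∃ u, Steps s u ∧ Steps s' u := by
  obtain ⟨C, h1, h2⟩ := exists_le_le s.pos s'.pos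
  obtain ⟨u, h3, h4⟩ := exists_steps_pos h1
  obtain ⟨u', h5, h6⟩ := exists_steps_pos h2
  have : u = u' := Steps.unique (h.trans h3) (h'.trans h5) (h4.trans h6.symm)
  subst this
  exact ⟨u, h3, h5⟩

/-- The equivalence relation on triples that is generated by expansions. -/
def tripleSetoid : Setoid Triple := Relation.EqvGen.setoid Step

theorem Steps.eqv {t s : Triple} (h : Steps t s) : tripleSetoid t s := by
  induction h with
  | refl => exact .refl _
  | tail _ h ih => exact .trans _ _ _ ih (.rel _ _ h)

/-- Equivalent triples have a common expansion. -/
theorem exists_common {t t' : Triple} (h : tripleSetoid t t') :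
    ∃ u, Steps t u ∧ Steps t' u := by
  change Relation.EqvGen Step t t' at h
  induction h with
  | rel x y h => exact ⟨y, .single h, .refl⟩
  | refl x => exact ⟨x, .refl, .refl⟩
  | symm x y _ ih => obtain ⟨u, h1, h2⟩ := ih; exact ⟨u, h2, h1⟩
  | trans x y z _ _ ih1 ih2 =>
    obtain ⟨u, h1, h2⟩ := ih1
    obtain ⟨v, h3, h4⟩ := ih2
    obtain ⟨w, h5, h6⟩ := Steps.join h2 h3
    exact ⟨w, h1.trans h5, h4.trans h6⟩

/-! ### The group operations on triples -/

/-- The triple `(T, 1, T)`. -/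
def Triple.id (T : Tree) : Triple := ⟨leaves T, T, 1, T, rfl, rfl⟩

/-- The inverse `(pos, β⁻¹, neg)` of the triple `(neg, β, pos)`. -/
def Triple.inv (t : Triple) : Triple := ⟨t.n, t.pos, t.braid⁻¹, t.neg, t.leaves_pos, t.leaves_neg⟩

theorem Triple.n_eq {t u : Triple} (h : t.pos = u.neg) : u.n = t.n := by
  rw [← t.leaves_pos, ← u.leaves_neg, h]

/-- The product `(A, βγ, C)` of the triples `(A, β, B)` and `(B, γ, C)`. -/
def Triple.mul (t u : Triple) (h : t.pos = u.neg) : Triple where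
  n := t.n
  neg := t.neg
  braid := t.braid * (Triple.n_eq h ▸ u.braid)
  pos := u.pos
  leaves_neg := t.leaves_neg
  leaves_pos := by rw [u.leaves_pos, Triple.n_eq h]

theorem Triple.inv_inv (t : Triple) : t.inv.inv = t :=
  Triple.mk_congr rfl (_root_.inv_inv t.braid) rfl

theorem Triple.inv_expand (t : Triple) {k : ℕ} (hk : k < t.n) :
    t.inv.expand (rho t.n t.braid k) (rho_lt t.braid hk) = (t.expand k hk).inv := by
  refine Triple.mk_congr ?_ ?_ rfl
  · change addCaret t.pos (rho t.n t.braid⁻¹ (rho t.n t.braid k)) = addCaret t.pos k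
    simp
  · change clone (rho t.n t.braid k) t.braid⁻¹ = (clone k t.braid)⁻¹
    rw [clone_inv]
    simp

theorem Steps.inv {t t' : Triple} (h : Steps t t') : Steps t.inv t'.inv := by
  induction h with
  | refl => exact .refl
  | tail _ h ih =>
    obtain ⟨k, hk, rfl⟩ := h
    exact ih.tail ⟨_, _, (Triple.inv_expand _ hk).symm⟩

theorem exists_steps_neg {t : Triple} {T : Tree} (h : Le t.neg T) :
    ∃ s, Steps t s ∧ s.neg = T := by
  obtain ⟨s, h1, h2⟩ := exists_steps_pos (t := t.inv) h
  exact ⟨s.inv, t.inv_inv ▸ Steps.inv h1, h2⟩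

theorem Steps.unique_neg {t s s' : Triple} (h : Steps t s) (h' : Steps t s')
    (e : s.neg = s'.neg) : s = s' := by
  rw [← s.inv_inv, ← s'.inv_inv, Steps.unique (Steps.inv h) (Steps.inv h') e]

theorem Triple.mk_one {n : ℕ} {T : Tree} (h : leaves T = n) : Triple.mk n T 1 T h h = .id T := by
  subst h; rfl

theorem steps_id {S T : Tree} (h : Le S T) : Steps (.id S) (.id T) := by
  obtain ⟨s, h1, h2⟩ := exists_steps_pos (t := .id S) h
  have key : ∀ u, Steps (.id S) u → u = .id u.pos := by
    intro u hu
    induction hu with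
    | refl => rfl
    | @tail b c _ h ih =>
      obtain ⟨k, hk, rfl⟩ := h
      have hk' : k < leaves b.pos := b.lt_pos hk
      have e : b.expand k hk = (Triple.id b.pos).expand k hk' := by
        congr 1
      have : (Triple.id b.pos).expand k hk' = .id (addCaret b.pos k) := by
        rw [← Triple.mk_one (leaves_addCaret _ hk')]
        refine Triple.mk_congr ?_ (clone_one k) rfl
        change addCaret b.pos (rho _ 1 k) = addCaret b.pos k
        rw [map_one, Equiv.Perm.one_apply]
      rw [e, this]; rfl
  rw [key s h1, h2] at h1
  exact h1

theorem Triple.mul_expand {t u : Triple} (h : t.pos = u.neg) {k : ℕ} (hk : k < u.n) :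
    ∃ (hl : rho u.n u.braid k < t.n) (h' : (t.expand _ hl).pos = (u.expand k hk).neg),
      (t.mul u h).expand k ((Triple.n_eq h) ▸ hk) = (t.expand _ hl).mul (u.expand k hk) h' := by
  obtain ⟨n, A, β, B, h1, h2⟩ := t
  obtain ⟨m, B', γ, C, h3, h4⟩ := u
  obtain rfl : B = B' := h
  obtain rfl : n = m := h2.symm.trans h3
  refine ⟨rho_lt γ hk, rfl, ?_⟩
  refine Triple.mk_congr ?_ ?_ rfl
  · change addCaret A (rho n (β * γ) k) = addCaret A _
    rw [map_mul]
    rfl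
  · exact clone_mul k β γ

theorem steps_mul {t u u' : Triple} (h : t.pos = u.neg) (hu : Steps u u') :
    ∃ t', Steps t t' ∧ ∃ h' : t'.pos = u'.neg, Steps (t.mul u h) (t'.mul u' h') := by
  induction hu with
  | refl => exact ⟨t, .refl, h, .refl⟩
  | tail _ hs ih =>
    obtain ⟨k, hk, rfl⟩ := hs
    obtain ⟨t', h1, h2, h3⟩ := ih
    obtain ⟨hl, h4, h5⟩ := Triple.mul_expand h2 hk
    exact ⟨_, h1.tail ⟨_, hl, rfl⟩, h4, h3.tail ⟨k, _, h5.symm⟩⟩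

theorem steps_mul_mul {t t' u u' : Triple} (ht : Steps t t') (hu : Steps u u')
    (h : t.pos = u.neg) (h' : t'.pos = u'.neg) : Steps (t.mul u h) (t'.mul u' h') := by
  obtain ⟨s, h1, h2, h3⟩ := steps_mul h hu
  obtain rfl : s = t' := Steps.unique h1 ht (h2.trans h'.symm)
  exact h3

theorem mul_eqv_mul {t t' u u' : Triple} (ht : tripleSetoid t t') (hu : tripleSetoid u u')
    (h : t.pos = u.neg) (h' : t'.pos = u'.neg) :
    tripleSetoid (t.mul u h) (t'.mul u' h') := by
  obtain ⟨p, h1, h2⟩ := exists_common ht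
  obtain ⟨q, h3, h4⟩ := exists_common hu
  obtain ⟨C, h5, h6⟩ := exists_le_le p.pos q.neg
  obtain ⟨r, h7, h8⟩ := exists_steps_pos h5
  obtain ⟨s, h9, h10⟩ := exists_steps_neg h6
  have e : r.pos = s.neg := h8.trans h10.symm
  exact tripleSetoid.trans (Steps.eqv (steps_mul_mul (h1.trans h7) (h3.trans h9) h e))
    (tripleSetoid.symm (Steps.eqv (steps_mul_mul (h2.trans h7) (h4.trans h9) h' e)))

/-- Any two triples have expansions whose product is defined. -/
theorem exists_matching (t u : Triple) :
    ∃ s v : Triple, Steps t s ∧ Steps u v ∧ s.pos = v.neg := by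
  obtain ⟨C, h1, h2⟩ := exists_le_le t.pos u.neg
  obtain ⟨s, h3, h4⟩ := exists_steps_pos h1
  obtain ⟨v, h5, h6⟩ := exists_steps_neg h2
  exact ⟨s, v, h3, h5, h4.trans h6.symm⟩

/-! ### The group `bV` -/

/-- The braided Thompson group `bV`: equivalence classes of representative triples. -/
def BV : Type := Quotient tripleSetoid

/-- The class of a triple. -/
def BV.mk (t : Triple) : BV := Quotient.mk tripleSetoid t

theorem BV.mk_eq_mk {t u : Triple} : BV.mk t = BV.mk u ↔ tripleSetoid t u := Quotient.eq

theorem BV.mk_eq_of_steps {t u : Triple} (h : Steps t u) : BV.mk t = BV.mk u :=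
  BV.mk_eq_mk.2 (Steps.eqv h)

theorem BV.exists_rep (x : BV) : ∃ t, BV.mk t = x := Quotient.exists_rep x

theorem BV.exists_mul (x y : BV) : ∃ (t u : Triple) (_ : t.pos = u.neg),
    BV.mk t = x ∧ BV.mk u = y := by
  obtain ⟨t, rfl⟩ := x.exists_rep
  obtain ⟨u, rfl⟩ := y.exists_rep
  obtain ⟨s, v, h1, h2, h⟩ := exists_matching t u
  exact ⟨s, v, h, (BV.mk_eq_of_steps h1).symm, (BV.mk_eq_of_steps h2).symm⟩

/-- The product of two classes: expand representatives until their product is defined.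
The result does not depend on the choices by `BV.mk_mul`. -/
noncomputable instance : Mul BV :=
  ⟨fun x y => BV.mk (Triple.mul _ _ (BV.exists_mul x y).choose_spec.choose_spec.choose)⟩

theorem BV.mk_mul {t u : Triple} (h : t.pos = u.neg) :
    BV.mk t * BV.mk u = BV.mk (t.mul u h) := by
  have hs := (BV.exists_mul (BV.mk t) (BV.mk u)).choose_spec.choose_spec.choose_spec
  exact BV.mk_eq_mk.2 (mul_eqv_mul (BV.mk_eq_mk.1 hs.1) (BV.mk_eq_mk.1 hs.2) _ h)

instance : One BV := ⟨BV.mk (.id .nil)⟩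

theorem BV.mk_id (T : Tree) : BV.mk (.id T) = 1 :=
  (BV.mk_eq_of_steps (steps_id (S := .nil) trivial)).symm

theorem inv_eqv_inv {t u : Triple} (h : tripleSetoid t u) : tripleSetoid t.inv u.inv := by
  obtain ⟨v, h1, h2⟩ := exists_common h
  exact tripleSetoid.trans (Steps.eqv (Steps.inv h1)) (tripleSetoid.symm (Steps.eqv (Steps.inv h2)))

instance : Inv BV := ⟨Quotient.map Triple.inv fun _ _ h => inv_eqv_inv h⟩

theorem BV.mk_inv (t : Triple) : (BV.mk t)⁻¹ = BV.mk t.inv := rfl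

theorem Triple.mul_assoc {t u v : Triple} (h1 : t.pos = u.neg) (h2 : u.pos = v.neg) :
    (t.mul u h1).mul v h2 = t.mul (u.mul v h2) h1 := by
  obtain ⟨n, A, β, B, _, h3⟩ := t
  obtain ⟨m, B', γ, C, h4, h5⟩ := u
  obtain ⟨l, C', δ, D, h6, h7⟩ := v
  obtain rfl : B = B' := h1
  obtain rfl : n = m := h3.symm.trans h4
  obtain rfl : C = C' := h2
  obtain rfl : n = l := h5.symm.trans h6
  exact Triple.mk_congr rfl (_root_.mul_assoc β γ δ) rfl

theorem Triple.id_mul (t : Triple) : (Triple.id t.neg).mul t rfl = t := by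
  obtain ⟨n, A, β, B, h1, h2⟩ := t
  subst h1
  exact Triple.mk_congr rfl (one_mul β) rfl

theorem Triple.inv_mul (t : Triple) : t.inv.mul t rfl = .id t.pos := by
  obtain ⟨n, A, β, B, h1, h2⟩ := t
  subst h2
  exact Triple.mk_congr rfl (inv_mul_cancel β) rfl

noncomputable instance : Group BV :=
  Group.ofLeftAxioms
    (by
      intro x y z
      obtain ⟨u, v, h1, rfl, rfl⟩ := BV.exists_mul y z
      obtain ⟨t, rfl⟩ := x.exists_rep
      obtain ⟨t', u', h2, h3, h4⟩ := exists_matching t u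
      obtain ⟨v', h5, h6⟩ := exists_steps_neg (t := v) (T := u'.pos) (h1 ▸ Steps.le_pos h3)
      rw [BV.mk_eq_of_steps h2, BV.mk_eq_of_steps h3, BV.mk_eq_of_steps h5, BV.mk_mul h4,
        BV.mk_mul (u := v') h6.symm, BV.mk_mul (t := t'.mul u' h4) h6.symm,
        BV.mk_mul (u := u'.mul v' h6.symm) h4, Triple.mul_assoc])
    (by
      intro x
      obtain ⟨t, rfl⟩ := x.exists_rep
      rw [← BV.mk_id t.neg, BV.mk_mul rfl, Triple.id_mul])
    (by
      intro x
      obtain ⟨t, rfl⟩ := x.exists_rep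
      rw [BV.mk_inv, BV.mk_mul rfl, Triple.inv_mul, BV.mk_id])

/-! ### The subgroup `bV^` -/

/-- The standard copy of `B_{n-1}` in `B_n`, which only braids the first `n - 1` strands. -/
def hatBraid (n : ℕ) : Subgroup (Braid n) :=
  Subgroup.closure {β | ∃ i, i + 2 < n ∧ β = sigma n i}

theorem rho_hat {n : ℕ} {β : Braid n} (h : β ∈ hatBraid n) : rho n β (n - 1) = n - 1 := by
  induction h using Subgroup.closure_induction with
  | mem β h =>
    obtain ⟨i, hi, rfl⟩ := h
    rw [rho_sigma (by omega)]
    exact Equiv.swap_apply_of_ne_of_ne (by omega) (by omega)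
  | one => simp
  | mul β γ _ _ h1 h2 => rw [map_mul, Equiv.Perm.mul_apply, h2, h1]
  | inv β _ h1 => rw [map_inv, Equiv.Perm.inv_eq_iff_eq, h1]

theorem clone_hat {n : ℕ} {β : Braid n} (h : β ∈ hatBraid n) :
    ∀ k, clone k β ∈ hatBraid (n + 1) := by
  induction h using Subgroup.closure_induction with
  | mem β h =>
    obtain ⟨i, hi, rfl⟩ := h
    intro k
    have h1 : sigma (n + 1) i ∈ hatBraid (n + 1) :=
      Subgroup.subset_closure ⟨i, by omega, rfl⟩
    have h2 : sigma (n + 1) (i + 1) ∈ hatBraid (n + 1) :=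
      Subgroup.subset_closure ⟨i + 1, by omega, rfl⟩
    rw [clone_sigma (by omega)]
    unfold cloneGen
    split_ifs
    exacts [h2, mul_mem h1 h2, mul_mem h2 h1, h1]
  | one => intro k; rw [clone_one]; exact one_mem _
  | mul β γ _ _ h1 h2 => intro k; rw [clone_mul]; exact mul_mem (h1 _) (h2 _)
  | inv β _ h1 => intro k; rw [clone_inv]; exact inv_mem (h1 _)

/-- The triples whose braid only braids the first `n - 1` strands. -/
def Triple.IsHat (t : Triple) : Prop := t.braid ∈ hatBraid t.n

theorem Triple.IsHat.steps {t u : Triple} (h : t.IsHat) (hs : Steps t u) : u.IsHat := by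
  induction hs with
  | refl => exact h
  | tail _ hs ih => obtain ⟨k, hk, rfl⟩ := hs; exact clone_hat ih k

theorem Triple.IsHat.mul {t u : Triple} (ht : t.IsHat) (hu : u.IsHat) (h : t.pos = u.neg) :
    (t.mul u h).IsHat := by
  obtain ⟨n, A, β, B, _, h3⟩ := t
  obtain ⟨m, B', γ, C, h4, h5⟩ := u
  obtain rfl : B = B' := h
  obtain rfl : n = m := h3.symm.trans h4
  exact mul_mem (S := Subgroup (Braid n)) (s := hatBraid n) ht hu

theorem exists_hat_matching {x y : BV} (hx : ∃ t : Triple, t.IsHat ∧ BV.mk t = x)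
    (hy : ∃ t : Triple, t.IsHat ∧ BV.mk t = y) :
    ∃ (t u : Triple) (_ : t.pos = u.neg), t.IsHat ∧ u.IsHat ∧ BV.mk t = x ∧ BV.mk u = y := by
  obtain ⟨t, ht, rfl⟩ := hx
  obtain ⟨u, hu, rfl⟩ := hy
  obtain ⟨s, v, h1, h2, h⟩ := exists_matching t u
  exact ⟨s, v, h, ht.steps h1, hu.steps h2, (BV.mk_eq_of_steps h1).symm,
    (BV.mk_eq_of_steps h2).symm⟩

/-- The subgroup of `bV` of all classes of triples `(neg, β, pos)` in which `β` only braids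
the first `n - 1` strands. -/
def BVHat : Subgroup BV where
  carrier := {x | ∃ t : Triple, t.IsHat ∧ BV.mk t = x}
  mul_mem' := by
    intro x y hx hy
    obtain ⟨t, u, h, ht, hu, rfl, rfl⟩ := exists_hat_matching hx hy
    exact ⟨_, ht.mul hu h, (BV.mk_mul h).symm⟩
  one_mem' := ⟨.id .nil, one_mem (hatBraid _), rfl⟩
  inv_mem' := by
    rintro x ⟨t, ht, rfl⟩
    exact ⟨t.inv, (hatBraid t.n).inv_mem ht, rfl⟩

/-! ### The homomorphism `χ₁` -/

/-- The right depth of `neg` minus the right depth of `pos`. -/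
def Triple.depthDiff (t : Triple) : ℤ := (rightDepth t.neg : ℤ) - rightDepth t.pos

theorem depthDiff_steps {t u : Triple} (ht : t.IsHat) (h : Steps t u) :
    t.depthDiff = u.depthDiff := by
  induction h with
  | refl => rfl
  | @tail b c hs h ih =>
    have hb : b.IsHat := ht.steps hs
    obtain ⟨k, hk, rfl⟩ := h
    rw [ih]
    have e := rho_hat hb
    have e1 : (b.expand k hk).depthDiff = (rightDepth (addCaret b.neg (rho b.n b.braid k)) : ℤ) -
        rightDepth (addCaret b.pos k) := rfl
    rw [e1, rightDepth_addCaret _ (b.lt_neg hk), rightDepth_addCaret _ (b.lt_pos hk),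
      b.leaves_neg, b.leaves_pos]
    by_cases h1 : k + 1 = b.n
    · obtain rfl : k = b.n - 1 := by omega
      rw [e, if_pos h1, if_pos h1]
      unfold Triple.depthDiff
      push_cast
      ring
    · have h2 : rho b.n b.braid k + 1 ≠ b.n := by
        intro h2
        have h3 : rho b.n b.braid k = rho b.n b.braid (b.n - 1) := by omega
        have := (rho b.n b.braid).injective h3
        omega
      rw [if_neg h1, if_neg h2]
      rfl

theorem depthDiff_eqv {t u : Triple} (ht : t.IsHat) (hu : u.IsHat) (h : BV.mk t = BV.mk u) :
    t.depthDiff = u.depthDiff := by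
  obtain ⟨v, h1, h2⟩ := exists_common (BV.mk_eq_mk.1 h)
  rw [depthDiff_steps ht h1, depthDiff_steps hu h2]

/-- The value of `χ₁` on an element of `BVHat`, computed with any representative whose braid only
braids the first `n - 1` strands; see `chiFun_eq`. -/
noncomputable def chiFun (x : BVHat) : ℤ := (x.2.choose).depthDiff

theorem chiFun_eq (x : BVHat) {t : Triple} (ht : t.IsHat) (h : BV.mk t = x) :
    chiFun x = t.depthDiff :=
  depthDiff_eqv x.2.choose_spec.1 ht (x.2.choose_spec.2.trans h.symm)

/-- The homomorphism `χ₁` from `BVHat` to the infinite cyclic group `ℤ` (written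
multiplicatively), which maps the class of a triple `(neg, β, pos)` in which `β` only braids the
first `n - 1` strands to the right depth of `neg` minus the right depth of `pos`. -/
noncomputable def chi₁ : BVHat →* Multiplicative ℤ :=
  MonoidHom.mk' (fun x => Multiplicative.ofAdd (chiFun x)) (by
    intro x y
    obtain ⟨t, u, h, ht, hu, hx, hy⟩ := exists_hat_matching x.2 y.2
    rw [chiFun_eq x ht hx, chiFun_eq y hu hy,
      chiFun_eq (x * y) (ht.mul hu h) (by rw [← BV.mk_mul h, hx, hy]; rfl), ← ofAdd_add]
    congr 1
    unfold Triple.depthDiff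
    rw [h]
    simp only [Triple.mul]
    ring)

theorem chi₁_mk {t : Triple} (ht : t.IsHat) :
    chi₁ ⟨BV.mk t, t, ht, rfl⟩ =
      Multiplicative.ofAdd ((rightDepth t.neg : ℤ) - (rightDepth t.pos : ℤ)) :=
  congrArg Multiplicative.ofAdd (chiFun_eq _ ht rfl)

/-- The kernel of `χ₁`. -/
noncomputable def DHat : Subgroup BVHat := chi₁.ker

end BraidedV

namespace BraidedV

/-! The derived subgroup lies in `DHat` because `chi₁` has a commutative target. For the converse,
it is enough that every homomorphism φ from `BVHat` to a commutative group kills `DHat`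
(`map_eq_one_of_mem_DHat`): the abelianisation map is such a φ, and its kernel is the derived
subgroup. Since [T, β, U] = [T, β, T][T, 1, U], the braid part and the tree part can be treated
separately.

Braid part. Conjugation by [T, 1, U] shows that φ[T, β, T] does not depend on T. The braid relation
identifies the values at consecutive generators, and expansion at the rightmost leaf links n strands
to n + 1. So all [T, σ_i, T] with i + 2 < n have one common value s (`map_mk_sigma_eq`). Let T_k be
T with a caret added to leaf k. Expanding [T, σ_i, T] at leaf i gives s = s² φ[T_{i+1}, 1, T_i], so
moving a caret one leaf to the right costs s⁻¹ (`map_sigma_mul_map_ofTrees`). After a further caret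
is added to leaf 0 of both trees, the move from leaf 0 to leaf 1 becomes a move across two leaves,
which costs s⁻². Hence s = 1 (`map_mk_sigma`).

Tree part. With s = 1, carets away from the rightmost leaf move freely as far as φ can see. Two
trees with equally many leaves and equal right depth are either equal or both contain such a caret.
In the latter case both carets are moved to leaf 0 and cancelled, and induction on the number of
leaves gives φ[T, 1, U] = 1 (`map_ofTrees`). -/

/-! ### Calculus of representatives in `BVHat` -/

theorem sigma_mem_hatBraid {n i : ℕ} (h : i + 2 < n) : sigma n i ∈ hatBraid n :=
  Subgroup.subset_closure ⟨i, h, rfl⟩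

/-- The element of `BVHat` represented by the triple `(T, β, U)`. -/
def BVHat.mk {n : ℕ} (T : Tree) (β : Braid n) (U : Tree) (hT : leaves T = n) (hU : leaves U = n)
    (hβ : β ∈ hatBraid n) : BVHat :=
  ⟨BV.mk ⟨n, T, β, U, hT, hU⟩, ⟨n, T, β, U, hT, hU⟩, hβ, rfl⟩

/-- The element of `BVHat` represented by the triple `(T, 1, U)`. -/
def BVHat.ofTrees (T U : Tree) (h : leaves T = leaves U) : BVHat :=
  BVHat.mk T (1 : Braid (leaves U)) U h rfl (one_mem _)

theorem BVHat.mk_mul_mk {n : ℕ} {T U V : Tree} {β γ : Braid n} (hT : leaves T = n)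
    (hU : leaves U = n) (hV : leaves V = n) (hβ : β ∈ hatBraid n) (hγ : γ ∈ hatBraid n) :
    BVHat.mk T β U hT hU hβ * BVHat.mk U γ V hU hV hγ =
      BVHat.mk T (β * γ) V hT hV (mul_mem hβ hγ) :=
  Subtype.ext (BV.mk_mul rfl)

theorem BVHat.mk_congr {n : ℕ} {T T' U U' : Tree} {β β' : Braid n} {hT hU hβ hT' hU' hβ'}
    (h1 : T = T') (h2 : β = β') (h3 : U = U') :
    BVHat.mk T β U hT hU hβ = BVHat.mk T' β' U' hT' hU' hβ' := by
  subst h1 h2 h3; rfl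

theorem BVHat.mk_one {n : ℕ} {T U : Tree} (hT : leaves T = n) (hU : leaves U = n) :
    BVHat.mk T (1 : Braid n) U hT hU (one_mem _) = BVHat.ofTrees T U (hT.trans hU.symm) := by
  subst hU; rfl

theorem BVHat.ofTrees_self (T : Tree) : BVHat.ofTrees T T rfl = 1 :=
  Subtype.ext (BV.mk_id T)

theorem BVHat.ofTrees_mul {T U V : Tree} (h1 : leaves T = leaves U) (h2 : leaves U = leaves V) :
    BVHat.ofTrees T U h1 * BVHat.ofTrees U V h2 = BVHat.ofTrees T V (h1.trans h2) := by
  rw [← BVHat.mk_one (h1.trans h2) h2, ofTrees, BVHat.mk_mul_mk (h1.trans h2) h2 rfl]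
  exact BVHat.mk_congr rfl (one_mul 1) rfl

/-- The source of every relation between different numbers of strands. It is used at the rightmost
leaf, which β fixes, and at the leaf i for σ_i. -/
theorem BVHat.mk_expand {n : ℕ} {T U : Tree} {β : Braid n} (hT : leaves T = n)
    (hU : leaves U = n) (hβ : β ∈ hatBraid n) {k : ℕ} (hk : k < n) :
    BVHat.mk T β U hT hU hβ =
      BVHat.mk (addCaret T (rho n β k)) (clone k β) (addCaret U k)
        (Triple.expand ⟨n, T, β, U, hT, hU⟩ k hk).leaves_neg
        (Triple.expand ⟨n, T, β, U, hT, hU⟩ k hk).leaves_pos (clone_hat hβ k) :=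
  Subtype.ext (BV.mk_eq_of_steps (.single ⟨k, hk, rfl⟩))

/-- Bifurcating a strand of the trivial braid gives the trivial braid, so carets on leaves with the
same index cancel. -/
theorem BVHat.ofTrees_addCaret {T U : Tree} (h : leaves T = leaves U) {k : ℕ}
    (hk : k < leaves U) :
    BVHat.ofTrees (addCaret T k) (addCaret U k)
        (by rw [leaves_addCaret T (h ▸ hk), leaves_addCaret U hk, h]) =
      BVHat.ofTrees T U h := by
  rw [← BVHat.mk_one (n := leaves U + 1) (by rw [leaves_addCaret T (h ▸ hk), h])
    (leaves_addCaret U hk), ofTrees, BVHat.mk_expand h rfl (one_mem _) hk]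
  exact BVHat.mk_congr (by simp) (clone_one k).symm rfl

/-! ### Right combs and removable carets -/

/-- A tree that is not a right comb is obtained by adding a caret to a leaf that is not the
rightmost one. -/
theorem exists_eq_addCaret (T : Tree) : leaves T = rightDepth T + 1 ∨
    ∃ (S : Tree) (k : ℕ), k + 1 < leaves S ∧ T = addCaret S k := by
  have nonempty : ∀ T : Tree, T = .nil ∨ ∃ (S : Tree) (k : ℕ), k < leaves S ∧ T = addCaret S k := by
    intro T
    induction T with
    | nil => exact Or.inl rfl
    | node _ l r hl hr =>
      right
      rcases hl with rfl | ⟨S, k, hk, rfl⟩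
      · rcases hr with rfl | ⟨S, k, hk, rfl⟩
        · exact ⟨.nil, 0, by simp [leaves], rfl⟩
        · refine ⟨.node () .nil S, k + 1, by simp only [leaves]; omega, ?_⟩
          simp [addCaret, leaves]
      · exact ⟨.node () S r, k, by simp only [leaves]; omega, by simp [addCaret, hk]⟩
  induction T with
  | nil => exact Or.inl rfl
  | node _ l r _ hr =>
    -- A caret removed from the left subtree leaves a leaf that is never the rightmost one, because
    -- the right subtree has a leaf of its own. Only if the left subtree is trivial must the right
    -- one be searched.
    rcases nonempty l with rfl | ⟨S, k, hk, rfl⟩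
    · rcases hr with h | ⟨S, k, hk, rfl⟩
      · left; simp only [leaves, rightDepth]; omega
      · refine Or.inr ⟨.node () .nil S, k + 1, by simp only [leaves]; omega, ?_⟩
        simp [addCaret, leaves]
    · have := leaves_pos r
      exact Or.inr ⟨.node () S r, k, by simp only [leaves]; omega, by simp [addCaret, hk]⟩

/-- A tree of right depth d has at least d + 1 leaves. Equality forces every left subtree along the
right edge to be trivial, so the tree is a right comb and its leaf count determines it. -/
theorem eq_of_leaves_eq_rightDepth {T U : Tree} (hT : leaves T = rightDepth T + 1)
    (hU : leaves U = rightDepth U + 1) (h : leaves T = leaves U) : T = U := by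
  have le : ∀ T : Tree, rightDepth T + 1 ≤ leaves T := by
    intro T
    induction T with
    | nil => simp [leaves, rightDepth]
    | node _ l r _ hr => have := leaves_pos l; simp only [leaves, rightDepth]; omega
  have leaf : ∀ T : Tree, leaves T = 1 → T = .nil := by
    intro T h
    cases T with
    | nil => rfl
    | node _ l r =>
      have := leaves_pos l; have := leaves_pos r; simp only [leaves] at h; omega
  induction T generalizing U with
  | nil => exact (leaf U h.symm).symm
  | node _ l r _ hr =>
    cases U with
    | nil => exact leaf _ h
    | node _ l' r' =>
      simp only [leaves, rightDepth] at hT hU h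
      have := le r; have := le r'; have := leaves_pos l; have := leaves_pos l'
      rw [leaf l (by omega), leaf l' (by omega), hr (U := r') (by omega) (by omega) (by omega)]

/-! ### Values of a homomorphism to a commutative group on braids -/

section CommGroup

variable {A : Type*} [CommGroup A] (φ : BVHat →* A)

theorem map_mk_mul {n : ℕ} {T : Tree} {β γ : Braid n} (hT : leaves T = n)
    (hβ : β ∈ hatBraid n) (hγ : γ ∈ hatBraid n) :
    φ (BVHat.mk T (β * γ) T hT hT (mul_mem hβ hγ)) =
      φ (BVHat.mk T β T hT hT hβ) * φ (BVHat.mk T γ T hT hT hγ) := by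
  rw [← map_mul, BVHat.mk_mul_mk]

/-- The splitting [T, β, U] = [T, β, T][T, 1, U] into a braid part and a tree part. -/
theorem map_mk_eq_mul_ofTrees {n : ℕ} {T U : Tree} {β : Braid n} (hT : leaves T = n)
    (hU : leaves U = n) (hβ : β ∈ hatBraid n) :
    φ (BVHat.mk T β U hT hU hβ) = φ (BVHat.mk T β T hT hT hβ) *
      φ (BVHat.ofTrees T U (hT.trans hU.symm)) := by
  rw [← BVHat.mk_one hT hU, ← map_mul, BVHat.mk_mul_mk]
  exact congrArg φ (BVHat.mk_congr rfl (mul_one β).symm rfl)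

/-- The image of `(T, β, T)` under a homomorphism to a commutative group does not depend on `T`. -/
theorem map_mk_tree_indep {n : ℕ} {T U : Tree} {β : Braid n} (hT : leaves T = n)
    (hU : leaves U = n) (hβ : β ∈ hatBraid n) :
    φ (BVHat.mk T β T hT hT hβ) = φ (BVHat.mk U β U hU hU hβ) := by
  -- Conjugation by [T, 1, U] takes [U, β, U] to [T, β, T].
  have h : BVHat.mk T β T hT hT hβ * BVHat.mk T 1 U hT hU (one_mem _) =
      BVHat.mk T 1 U hT hU (one_mem _) * BVHat.mk U β U hU hU hβ := by
    rw [BVHat.mk_mul_mk, BVHat.mk_mul_mk]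
    exact BVHat.mk_congr rfl ((mul_one β).trans (one_mul β).symm) rfl
  have := congrArg φ h
  rw [map_mul, map_mul, mul_comm] at this
  exact mul_left_cancel this

/-- In a commutative group the braid relation aba = bab collapses to a = b. The bound i + 3 < n
keeps σ_{i+1} away from the last strand. -/
theorem map_mk_sigma_succ {n i : ℕ} {T : Tree} (hT : leaves T = n) (h : i + 3 < n) :
    φ (BVHat.mk T (sigma n (i + 1)) T hT hT (sigma_mem_hatBraid (by omega))) =
      φ (BVHat.mk T (sigma n i) T hT hT (sigma_mem_hatBraid (by omega))) := by
  have h1 := sigma_mem_hatBraid (n := n) (i := i) (by omega)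
  have h2 := sigma_mem_hatBraid (n := n) (i := i + 1) (by omega)
  have e : φ (BVHat.mk T _ T hT hT (mul_mem (mul_mem h1 h2) h1)) =
      φ (BVHat.mk T _ T hT hT (mul_mem (mul_mem h2 h1) h2)) :=
    congrArg φ (BVHat.mk_congr rfl (sigma_braid n (by omega)) rfl)
  rw [map_mk_mul φ hT (mul_mem h1 h2) h1, map_mk_mul φ hT (mul_mem h2 h1) h2,
    map_mk_mul φ hT h1 h2, map_mk_mul φ hT h2 h1,
    mul_comm (φ (BVHat.mk T (sigma n (i + 1)) _ _ _ _))] at e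
  exact (mul_left_cancel e).symm

theorem map_mk_sigma_zero {n i : ℕ} {T : Tree} (hT : leaves T = n) (h : i + 2 < n) :
    φ (BVHat.mk T (sigma n i) T hT hT (sigma_mem_hatBraid h)) =
      φ (BVHat.mk T (sigma n 0) T hT hT (sigma_mem_hatBraid (by omega))) := by
  induction i with
  | zero => rfl
  | succ i ih => rw [map_mk_sigma_succ φ hT h, ih (by omega)]

/-- Expansion at the rightmost leaf n - 1: the strand there is straight and, as n > 2, is not
involved in σ_0. So bifurcating it turns σ_0 in B_n into σ_0 in B_{n+1}. -/
theorem map_mk_sigma_addCaret {n : ℕ} {T U : Tree} (hT : leaves T = n) (hU : leaves U = n + 1)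
    (h : 2 < n) :
    φ (BVHat.mk U (sigma (n + 1) 0) U hU hU (sigma_mem_hatBraid (by omega))) =
      φ (BVHat.mk T (sigma n 0) T hT hT (sigma_mem_hatBraid h)) := by
  have hk : n - 1 < leaves T := by omega
  have hT' : leaves (addCaret T (n - 1)) = n + 1 := by rw [leaves_addCaret _ hk, hT]
  rw [BVHat.mk_expand hT hT (sigma_mem_hatBraid h) (k := n - 1) (by omega),
    map_mk_tree_indep φ hU hT']
  refine congrArg φ (BVHat.mk_congr ?_ ?_ rfl)
  · rw [rho_hat (sigma_mem_hatBraid h)]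
  · rw [clone_sigma (by omega), cloneGen_gt (by omega)]

/-- All elements `(T, σ_i, T)` of `BVHat` have the same image in a commutative group. -/
theorem map_mk_sigma_eq {n m i j : ℕ} {T U : Tree} (hT : leaves T = n) (hU : leaves U = m)
    (hi : i + 2 < n) (hj : j + 2 < m) :
    φ (BVHat.mk T (sigma n i) T hT hT (sigma_mem_hatBraid hi)) =
      φ (BVHat.mk U (sigma m j) U hU hU (sigma_mem_hatBraid hj)) := by
  -- The right comb with three leaves is the reference point, since 3 is the least number of strands
  -- for which σ_0 avoids the last strand.
  have key : ∀ (m : ℕ) (U : Tree) (hU : leaves U = m) (h : 2 < m),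
      φ (BVHat.mk U (sigma m 0) U hU hU (sigma_mem_hatBraid h)) =
        φ (BVHat.mk (n := 3) (.node () .nil (.node () .nil .nil)) (sigma 3 0)
          (.node () .nil (.node () .nil .nil)) rfl rfl
          (sigma_mem_hatBraid (by omega))) := by
    intro m
    induction m with
    | zero => intro _ _ h; omega
    | succ m ih =>
      intro U hU h
      rcases (by omega : m = 2 ∨ 2 < m) with rfl | h'
      · exact map_mk_tree_indep φ _ _ _
      -- By tree independence any tree with m leaves serves for the step from m to m + 1; one is
      -- built by repeatedly grafting onto a new root.
      · obtain ⟨T, hT⟩ : ∃ T : Tree, leaves T = m := by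
          clear * - h'
          induction m, (by omega : 1 ≤ m) using Nat.le_induction with
          | base => exact ⟨.nil, rfl⟩
          | succ m hm ih =>
            rcases (by omega : m = 2 ∨ 2 < m) with rfl | h
            · exact ⟨.node () .nil (.node () .nil .nil), rfl⟩
            · obtain ⟨T, hT⟩ := ih h
              exact ⟨.node () T .nil, by simp only [leaves, hT]⟩
        rw [map_mk_sigma_addCaret φ hT hU h', ih T hT h']
  rw [map_mk_sigma_zero φ hT hi, map_mk_sigma_zero φ hU hj, key n T hT (by omega),
    key m U hU (by omega)]

/-- Moving a caret from a leaf to the next one amounts to a half-twist in a commutative group. -/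
theorem map_sigma_mul_map_ofTrees {n i : ℕ} {T : Tree} (hT : leaves T = n) (h : i + 2 < n) :
    φ (BVHat.mk T (sigma n i) T hT hT (sigma_mem_hatBraid h)) *
      φ (BVHat.ofTrees (addCaret T (i + 1)) (addCaret T i)
        (by rw [leaves_addCaret T (by omega), leaves_addCaret T (by omega)])) = 1 := by
  have l1 : leaves (addCaret T i) = n + 1 := by rw [leaves_addCaret T (by omega), hT]
  have l2 : leaves (addCaret T (i + 1)) = n + 1 := by rw [leaves_addCaret T (by omega), hT]
  have h1 := sigma_mem_hatBraid (n := n + 1) (i := i) (by omega)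
  have h2 := sigma_mem_hatBraid (n := n + 1) (i := i + 1) (by omega)
  have e : φ (BVHat.mk T (sigma n i) T hT hT (sigma_mem_hatBraid h)) =
      φ (BVHat.mk (addCaret T (i + 1)) _ (addCaret T i) l2 l1 (mul_mem h1 h2)) := by
    -- The strand from leaf i ends at i + 1. The upper tree therefore receives its caret at i + 1,
    -- and the bifurcated braid is σ_i σ_{i+1}.
    rw [BVHat.mk_expand hT hT (sigma_mem_hatBraid h) (k := i) (by omega)]
    refine congrArg φ (BVHat.mk_congr ?_ ?_ rfl)
    · rw [rho_sigma (by omega), Equiv.swap_apply_left]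
    · rw [clone_sigma (by omega), cloneGen_self]
  -- Both generators of the bifurcated braid have the same value s as the original one, so `e` reads
  -- s = s · (s · φ[T_{i+1}, 1, T_i]).
  rw [map_mk_eq_mul_ofTrees φ l2 l1, map_mk_mul φ l2 h1 h2,
    map_mk_sigma_eq φ l2 hT (by omega : i + 2 < n + 1) h,
    map_mk_sigma_eq φ l2 hT (by omega : i + 1 + 2 < n + 1) h, mul_assoc] at e
  exact (mul_eq_left.1 e.symm)

/-- The same tree pair is written once as a move of a caret by one leaf and once as a composite of
two such moves. Comparing the costs gives s⁻¹ = s⁻¹ s⁻¹. -/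
theorem map_mk_sigma {n i : ℕ} {T : Tree} (hT : leaves T = n) (h : i + 2 < n) :
    φ (BVHat.mk T (sigma n i) T hT hT (sigma_mem_hatBraid h)) = 1 := by
  have h0 : 0 + 2 < leaves T := by omega
  have l0 : leaves (addCaret T 0) = leaves T + 1 := leaves_addCaret T (by omega)
  have l1 : leaves (addCaret T 1) = leaves T + 1 := leaves_addCaret T (by omega)
  have m0 : leaves (addCaret (addCaret T 0) 0) = leaves T + 2 := by
    rw [leaves_addCaret _ (by omega), l0]
  have m1 : leaves (addCaret (addCaret T 0) 1) = leaves T + 2 := by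
    rw [leaves_addCaret _ (by omega), l0]
  have m2 : leaves (addCaret (addCaret T 0) 2) = leaves T + 2 := by
    rw [leaves_addCaret _ (by omega), l0]
  have e0 := map_sigma_mul_map_ofTrees φ (T := T) (i := 0) rfl h0
  have e1 := map_sigma_mul_map_ofTrees φ (T := addCaret T 0) (i := 0) rfl (by omega)
  have e2 := map_sigma_mul_map_ofTrees φ (T := addCaret T 0) (i := 1) rfl (by omega)
  rw [map_mk_sigma_eq φ rfl hT h0 h] at e0
  rw [map_mk_sigma_eq φ rfl hT (by omega : 0 + 2 < leaves (addCaret T 0)) h] at e1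
  rw [map_mk_sigma_eq φ rfl hT (by omega : 1 + 2 < leaves (addCaret T 0)) h] at e2
  -- Adding a caret to leaf 0 of both trees on the left shifts the caret at leaf 1 of the first tree
  -- to leaf 2. The result is the pair with carets at the leaves 2 and 0 of `addCaret T 0`, which
  -- factors through leaf 1.
  have c : BVHat.ofTrees (addCaret T 1) (addCaret T 0) (by omega) =
      BVHat.ofTrees (addCaret (addCaret T 0) 2) (addCaret (addCaret T 0) 1) (by omega) *
      BVHat.ofTrees (addCaret (addCaret T 0) 1) (addCaret (addCaret T 0) 0) (by omega) := by
    rw [BVHat.ofTrees_mul, ← BVHat.ofTrees_addCaret (k := 0) _ (by omega)]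
    have := addCaret_addCaret T (k := 1) (l := 0) (by omega) (by omega)
    simp only [shift] at this
    congr 1
  have c' := congrArg φ c
  rw [map_mul, eq_inv_of_mul_eq_one_right e0, eq_inv_of_mul_eq_one_right e1,
    eq_inv_of_mul_eq_one_right e2] at c'
  exact inv_eq_one.1 (mul_eq_left.1 c'.symm)

/-- For fixed T the value is multiplicative in β, and the generators of `hatBraid n` have value 1.
-/
theorem map_mk_self {n : ℕ} {T : Tree} {β : Braid n} (hT : leaves T = n)
    (hβ : β ∈ hatBraid n) : φ (BVHat.mk T β T hT hT hβ) = 1 := by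
  induction hβ using Subgroup.closure_induction with
  | mem β h => obtain ⟨i, hi, rfl⟩ := h; exact map_mk_sigma φ hT hi
  | one => subst hT; exact (congrArg φ (BVHat.ofTrees_self T)).trans (map_one φ)
  | mul β γ hβ hγ h1 h2 => rw [map_mk_mul φ hT hβ hγ, h1, h2, one_mul]
  | inv β hβ h =>
    have e := map_mk_mul φ hT hβ (inv_mem hβ)
    rw [h, one_mul] at e
    rw [← e]
    subst hT
    refine (congrArg φ ?_).trans (map_one φ)
    rw [← BVHat.ofTrees_self T]
    exact BVHat.mk_congr rfl (mul_inv_cancel β) rfl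

/-! ### Values on pairs of trees -/

/-- The caret travels to leaf 0 one leaf at a time, and each move is now free. The rightmost leaf is
excluded because a caret there would change the right depth. -/
theorem map_ofTrees_addCaret_zero {T : Tree} {i : ℕ} (h : i + 1 < leaves T) :
    φ (BVHat.ofTrees (addCaret T i) (addCaret T 0)
      (by rw [leaves_addCaret T (by omega), leaves_addCaret T (by omega)])) = 1 := by
  induction i with
  | zero => rw [BVHat.ofTrees_self, map_one]
  | succ i ih =>
    have e := map_sigma_mul_map_ofTrees φ (T := T) (i := i) rfl h
    rw [map_mk_sigma φ rfl h, one_mul] at e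
    have l : leaves (addCaret T (i + 1)) = leaves (addCaret T i) := by
      rw [leaves_addCaret T (by omega), leaves_addCaret T (by omega)]
    have l' : leaves (addCaret T i) = leaves (addCaret T 0) := by
      rw [leaves_addCaret T (by omega), leaves_addCaret T (by omega)]
    rw [← BVHat.ofTrees_mul l l', map_mul, e, ih (by omega), one_mul]

theorem map_ofTrees {T U : Tree} (h : leaves T = leaves U) (hd : rightDepth T = rightDepth U) :
    φ (BVHat.ofTrees T U h) = 1 := by
  induction hn : leaves T generalizing T U with
  | zero => have := leaves_pos T; omega
  | succ n ih =>
    -- If one of the trees is a right comb, the equal leaf counts and right depths make the other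
    -- one a right comb too, and the trees coincide.
    rcases exists_eq_addCaret T with hT | ⟨T', i, hi, rfl⟩
    · obtain rfl := eq_of_leaves_eq_rightDepth hT (by omega) h
      rw [BVHat.ofTrees_self, map_one]
    rcases exists_eq_addCaret U with hU | ⟨U', j, hj, rfl⟩
    · obtain rfl := eq_of_leaves_eq_rightDepth (by omega) hU h
      rw [BVHat.ofTrees_self, map_one]
    have hT0 := leaves_addCaret T' (k := 0) (by omega)
    have hU0 := leaves_addCaret U' (k := 0) (by omega)
    have hTi := leaves_addCaret T' (k := i) (by omega)
    have hUj := leaves_addCaret U' (k := j) (by omega)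
    -- Neither caret sits on the rightmost leaf, so the smaller trees still have equal right depth
    -- and the induction hypothesis applies.
    rw [rightDepth_addCaret T' (by omega), rightDepth_addCaret U' (by omega),
      if_neg (by omega), if_neg (by omega)] at hd
    have e := map_ofTrees_addCaret_zero φ hj
    have e' : φ (BVHat.ofTrees (addCaret U' 0) (addCaret U' j) (by omega)) = 1 := by
      have c := congrArg φ (BVHat.ofTrees_mul (T := addCaret U' j) (U := addCaret U' 0)
        (V := addCaret U' j) (by omega) (by omega))
      rwa [map_mul, e, one_mul, BVHat.ofTrees_self, map_one] at c
    -- The path runs from T' with its caret at i, to T' and then U' with the caret at 0, to U' with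
    -- its caret at j. The outer factors are free, and the middle one reduces to the pair (T', U').
    rw [← BVHat.ofTrees_mul (T := addCaret T' i) (U := addCaret T' 0) (by omega) (by omega),
      ← BVHat.ofTrees_mul (T := addCaret T' 0) (U := addCaret U' 0) (by omega) (by omega),
      map_mul, map_mul, map_ofTrees_addCaret_zero φ hi, e',
      BVHat.ofTrees_addCaret (by omega) (by omega), ih (by omega) hd (by omega), mul_one, one_mul]

/-- A homomorphism from `BVHat` to a commutative group is trivial on the kernel of `χ₁`. -/
theorem map_eq_one_of_mem_DHat {x : BVHat} (hx : x ∈ DHat) : φ x = 1 := by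
  obtain ⟨_, ⟨n, T, β, U, hT, hU⟩, hβ, rfl⟩ := x
  have hd : rightDepth T = rightDepth U := by
    have h := chi₁_mk hβ
    rw [MonoidHom.mem_ker.1 hx] at h
    have := congrArg Multiplicative.toAdd h
    simp only [toAdd_one, toAdd_ofAdd] at this
    omega
  refine (map_mk_eq_mul_ofTrees φ hT hU hβ).trans ?_
  rw [map_ofTrees φ _ hd, mul_one]
  exact map_mk_self φ hT hβ

end CommGroup

/-! ### The derived subgroup and the abelianisation -/

theorem commutator_eq_DHat : commutator BVHat = DHat := by
  refine le_antisymm (Abelianization.commutator_subset_ker chi₁) fun x hx => ?_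
  rw [← Abelianization.ker_of]
  exact map_eq_one_of_mem_DHat Abelianization.of hx

theorem chi₁_surjective : Function.Surjective chi₁ := by
  intro z
  -- The two trees with three leaves have right depths 2 and 1, so their pair is mapped to the
  -- generator 1 of ℤ.
  let T : Tree := .node () .nil (.node () .nil .nil)
  let U : Tree := .node () (.node () .nil .nil) .nil
  have h : chi₁ (BVHat.ofTrees T U rfl) = Multiplicative.ofAdd 1 :=
    (chi₁_mk (t := ⟨3, T, 1, U, rfl, rfl⟩) (one_mem _)).trans (by simp [T, U, rightDepth])
  refine ⟨BVHat.ofTrees T U rfl ^ z.toAdd, ?_⟩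
  rw [map_zpow, h, ← ofAdd_zsmul]
  simp

end BraidedV

theorem corollary2p9 :
    commutator BraidedV.BVHat = BraidedV.DHat ∧
    ∃ e : Abelianization BraidedV.BVHat ≃* Multiplicative ℤ,
      ∀ x : BraidedV.BVHat, e (Abelianization.of x) = BraidedV.chi₁ x := by
  refine ⟨BraidedV.commutator_eq_DHat,
    MulEquiv.ofBijective (Abelianization.lift BraidedV.chi₁) ⟨?_, ?_⟩, fun x => ?_⟩
  · refine (injective_iff_map_eq_one (Abelianization.lift BraidedV.chi₁)).2 fun a => ?_
    obtain ⟨x, rfl⟩ := QuotientGroup.mk_surjective a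
    intro h
    -- The hypothesis `h` unfolds to x ∈ `DHat`, so the abelianisation map sends x to 1.
    exact BraidedV.map_eq_one_of_mem_DHat Abelianization.of (x := x) h
  · intro z
    obtain ⟨x, rfl⟩ := BraidedV.chi₁_surjective z
    exact ⟨Abelianization.of x, Abelianization.lift_apply_of BraidedV.chi₁ x⟩
  · exact Abelianization.lift_apply_of BraidedV.chi₁ x
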